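/- All curves are planar. For a regular curve $\gamma:[0,1]\to\mathbb{R}^2$ of class $H^2$ (i.e. $\gamma\in C^1([0,1])$ with $\gamma'$ absolutely continuous, $\gamma''\in L^2(0,1)$, and $\gamma'(x)\neq 0$ for all $x\in[0,1]$) let $\partial_s=|\gamma'|^{-1}\partial_x$ be the arclength derivative, $\tau=\partial_s\gamma$ the unit tangent, $\nu$ its anticlockwise rotation by $\pi/2$, and $k$ the (a.e. defined) scalar curvature, $\partial_s^2\gamma=k\nu$. The penalized elastic energy is $$F(\gamma)=\int_\gamma (k^2+1)\,ds=\int_0^1 (k^2+1)\,|\gamma'|\,dx .$$ For a curve defined on $\mathbb{S}^1=\mathbb{R}/\mathbb{Z}$ the class $H^2$, regularity and $F$ are understood through its $1$-periodic lift to $\mathbb{R}$ (class $H^2$ and regularity on every compact interval, and $F$ computed over one period $[0,1]$). A \emph{drop} is a regular curve $\gamma:[0,1]\to\mathbb{R}^2$ of class $H^2$ with $\gamma(0)=\gamma(1)$ (no condition is imposed on the tangents at the end points). A \emph{double drop} $\mathcal{D}=\{\gamma^1,\gamma^2\}$ consists of two drops with a common base point $P=\gamma^1(0)=\gamma^1(1)=\gamma^2(0)=\gamma^2(1)$,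 and $F(\mathcal{D})=F(\gamma^1)+F(\gamma^2)$. A double drop is \emph{symmetric} if, up to reparametrization of $[0,1]$ by a homeomorphism (orientation-reversing ones are allowed), $\gamma^2$ is the image of $\gamma^1$ under the point reflection in $P$. Put \begin{align*} m&:=\inf\{F(\gamma)\mid \gamma \text{ is a drop}\},\\ n&:=\inf\{F(\mathcal{D})\mid \mathcal{D}\text{ is a double drop}\},\\ \tilde n&:=\inf\{F(\mathcal{SD})\mid \mathcal{SD}\text{ is a symmetric double drop}\},\\ \overline n&:=\inf\{F(\varphi)\mid \varphi:\mathbb{S}^1\to\mathbb{R}^2 \text{ is a regular curve of class } H^2 \text{ and there exist } s_1\neq s_2\in\mathbb{S}^1 \text{ with } \varphi(s_1)=\varphi(s_2)\}. \end{align*} Then $$n=\tilde n=\overline n=2m,$$ and the infima $n$, $\tilde n$, $\overline n$ are all attained. -/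

import Mathlib

open MeasureTheory Set

namespace ElasticDrop

/-- The Euclidean plane. -/
abbrev Plane : Type := EuclideanSpace ℝ (Fin 2)

/-- Anticlockwise rotation by a right angle. -/
def rot (v : Plane) : Plane := !₂[-v 1, v 0]

/-- The derivative `∂ₓ f` on the interval `[a, b]` (one-sided at the end points). Only the values
of `f` on `[a, b]` matter, for points of `[a, b]`. -/
noncomputable def dx (a b : ℝ) (f : ℝ → Plane) : ℝ → Plane :=
  derivWithin f (Icc a b)

/-- `f` is of class `H²` on the compact interval `[a, b]`: it is continuously differentiable, its
derivative is absolutely continuous, and the (almost everywhere defined) second derivative is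
square integrable. -/
structure IsH2On (f : ℝ → Plane) (a b : ℝ) : Prop where
  contDiffOn : ContDiffOn ℝ 1 f (Icc a b)
  absolutelyContinuous : AbsolutelyContinuousOnInterval (dx a b f) a b
  memLp : MemLp (dx a b (dx a b f)) 2 (volume.restrict (Icc a b))

/-- `f` restricted to `[a, b]` is a regular curve of class `H²`. -/
structure IsRegularH2On (f : ℝ → Plane) (a b : ℝ) : Prop where
  isH2On : IsH2On f a b
  regular : ∀ x ∈ Icc a b, dx a b f x ≠ 0

/-- The arclength derivative `∂ₛ = |∂ₓγ|⁻¹ ∂ₓ` along a curve `γ` on `[0, 1]`, applied to `f`. -/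
noncomputable def ds (γ f : ℝ → Plane) (x : ℝ) : Plane :=
  ‖dx 0 1 γ x‖⁻¹ • dx 0 1 f x

/-- The unit tangent vector `τ = ∂ₛγ`. -/
noncomputable def tangent (γ : ℝ → Plane) : ℝ → Plane := ds γ γ

/-- The unit normal vector, the anticlockwise rotation of the unit tangent. -/
noncomputable def normal (γ : ℝ → Plane) (x : ℝ) : Plane := rot (tangent γ x)

/-- The scalar curvature `k`, that is, the coefficient in `∂ₛ²γ = k ν`. For a regular curve of class
`H²` it is defined almost everywhere. -/
noncomputable def curvature (γ : ℝ → Plane) (x : ℝ) : ℝ :=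
  inner ℝ (ds γ (tangent γ) x) (normal γ x)

/-- The penalized elastic energy `F(γ) = ∫_γ (k² + 1) ds` of a curve parametrized on `[0, 1]`. -/
noncomputable def energy (γ : ℝ → Plane) : ℝ :=
  ∫ x in (0 : ℝ)..1, (curvature γ x ^ 2 + 1) * ‖dx 0 1 γ x‖

/-- A drop: a regular `H²` curve on `[0, 1]` with coinciding end points (there is no condition on
the tangents there). -/
structure IsDrop (γ : ℝ → Plane) : Prop where
  regularH2 : IsRegularH2On γ 0 1
  closed : γ 0 = γ 1

/-- The infimum `m` of the energy among drops. -/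
noncomputable def m : ℝ := sInf {e : ℝ | ∃ γ : ℝ → Plane, IsDrop γ ∧ energy γ = e}

/-- A double drop: a network of two drops with a common base point (the four-point). -/
structure DoubleDrop where
  γ₁ : ℝ → Plane
  γ₂ : ℝ → Plane
  isDrop₁ : IsDrop γ₁
  isDrop₂ : IsDrop γ₂
  base_eq : γ₁ 0 = γ₂ 0

namespace DoubleDrop

/-- The four-point. -/
def fourPoint (D : DoubleDrop) : Plane := D.γ₁ 0

/-- The energy of a network is the sum of the energies of its curves. -/
noncomputable def totalEnergy (D : DoubleDrop) : ℝ := energy D.γ₁ + energy D.γ₂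

/-- A double drop is symmetric if its two drops are symmetric with respect to the four-point: up to
a change of parameter (of either orientation) of `[0, 1]`, the second drop is the image of the
first one under the point reflection in the four-point. -/
def IsSymmetric (D : DoubleDrop) : Prop :=
  ∃ σ : unitInterval ≃ₜ unitInterval, ∀ t : unitInterval,
    D.γ₂ t = Equiv.pointReflection D.fourPoint (D.γ₁ (σ t))

end DoubleDrop

/-- The lift to `ℝ` of a map from the circle `𝕊¹ = ℝ / ℤ`. -/
def lift (φ : UnitAddCircle → Plane) (x : ℝ) : Plane := φ (x : UnitAddCircle)

/-- A closed regular curve of class `H²` defined on the circle `𝕊¹ = ℝ / ℤ`: its periodic lift is a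
regular curve of class `H²` on every compact interval. -/
def IsClosedRegularH2 (φ : UnitAddCircle → Plane) : Prop :=
  ∀ a b : ℝ, a < b → IsRegularH2On (lift φ) a b

/-- The energy of a curve defined on the circle. -/
noncomputable def closedEnergy (φ : UnitAddCircle → Plane) : ℝ := energy (lift φ)

/-- The energies of all double drops. -/
def doubleDropEnergies : Set ℝ :=
  {e | ∃ D : DoubleDrop, D.totalEnergy = e}

/-- The energies of all symmetric double drops. -/
def symmetricDoubleDropEnergies : Set ℝ :=
  {e | ∃ D : DoubleDrop, D.IsSymmetric ∧ D.totalEnergy = e}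

/-- The energies of all closed regular `H²` curves with at least one self-intersection. -/
def selfIntersectingEnergies : Set ℝ :=
  {e | ∃ φ : UnitAddCircle → Plane, IsClosedRegularH2 φ ∧
    (∃ s₁ s₂ : UnitAddCircle, s₁ ≠ s₂ ∧ φ s₁ = φ s₂) ∧ closedEnergy φ = e}

end ElasticDrop

/-!
Reversing a drop and reflecting it in its base point produces a drop whose initial velocity is the
final velocity of the original one, and conversely. Hence a drop followed by its reversed point
reflection is always a closed `C¹` curve, with no condition on the tangents, and a minimal drop
yields both a symmetric double drop and a self-intersecting closed curve of energy `2 m`.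
Conversely, a self-intersecting closed curve is the union of two drops. Everything therefore
reduces to the existence of a drop of minimal energy.

For a curve of length `L` and bending energy `B = ∫ k² ds`, the energy `B + L` is at least
`2 √(L B)`, with equality after a suitable dilation, and the scale invariant product `L B` equals
`∫₀¹ |T'|²`, where `T` is the unit tangent of the parametrization on `[0, 1]` with constant speed.
So the problem is to minimize the norm of `u = T'` in `L²` among the data with `|T| = 1` everywhere
and `∫₀¹ T = 0` (`IsTangentData`). The second condition determines the initial tangent through
`u`, and the first says that certain continuous linear images of `u` lie on the unit circle. Such
a constraint set is weakly closed, so by the Banach-Alaoglu theorem it has an element of least norm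
(`exists_min_norm_of_mem_closed`, `exists_minimal_isTangentData`).

The two directions of the reduction are `IsRegularH2On.two_sqrt_le_integral_energyDensity`, the
lower bound obtained by parametrizing an arbitrary closed arc proportionally to arclength, and
`energy_curveOfTangent`, the energy of the constant speed curve built from tangent data.
-/

namespace ElasticDrop

/-! ### Absolutely continuous plane curves -/

/-- Absolute continuity passes from `f` to every function whose increments are controlled by those
of `f`. -/
theorem _root_.AbsolutelyContinuousOnInterval.of_dist_le {X Y : Type*} [PseudoMetricSpace X]
    [PseudoMetricSpace Y] {f : ℝ → X} {g : ℝ → Y} {a b K : ℝ}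
    (hf : AbsolutelyContinuousOnInterval f a b)
    (h : ∀ x ∈ uIcc a b, ∀ y ∈ uIcc a b, dist (g x) (g y) ≤ K * dist (f x) (f y)) :
    AbsolutelyContinuousOnInterval g a b := by
  have hK := Filter.Tendsto.const_mul K hf
  rw [mul_zero] at hK
  refine squeeze_zero' (Filter.Eventually.of_forall fun E => Finset.sum_nonneg fun i _ =>
    dist_nonneg) ?_ hK
  filter_upwards [Filter.mem_inf_of_right (Filter.mem_principal_self _)] with E hE
  rw [Finset.mul_sum]
  exact Finset.sum_le_sum fun i hi => h _ (hE.1 i hi).1 _ (hE.1 i hi).2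

theorem intervalIntegral_apply {f : ℝ → Plane} {a b : ℝ} (hf : IntervalIntegrable f volume a b)
    (i : Fin 2) : (∫ x in a..b, f x) i = ∫ x in a..b, f x i :=
  ((EuclideanSpace.proj (𝕜 := ℝ) i).intervalIntegral_comp_comm hf).symm

/-- The fundamental theorem of calculus for absolutely continuous curves in the plane. -/
theorem integral_deriv_eq_sub_of_absolutelyContinuous {f : ℝ → Plane} {a b : ℝ}
    (hf : AbsolutelyContinuousOnInterval f a b) (hint : IntervalIntegrable (deriv f) volume a b) :
    ∫ x in a..b, deriv f x = f b - f a := by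
  ext i
  have hfi : AbsolutelyContinuousOnInterval (fun x => f x i) a b :=
    hf.of_dist_le (K := 1) fun x _ y _ => by
      rw [one_mul, dist_eq_norm, dist_eq_norm, ← PiLp.sub_apply]
      exact PiLp.norm_apply_le _ _
  rw [intervalIntegral_apply hint, PiLp.sub_apply, ← hfi.integral_deriv_eq_sub]
  refine intervalIntegral.integral_congr_ae ?_
  filter_upwards [hf.boundedVariationOn.ae_differentiableAt_of_mem_uIcc] with x hx hxm
  have := ((EuclideanSpace.proj (𝕜 := ℝ) i).hasFDerivAt.comp_hasDerivAt x
    (hx (uIoc_subset_uIcc hxm)).hasDerivAt)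
  exact this.deriv.symm

/-- Reduction to the scalar case by splitting the integral into its two coordinates. -/
theorem absolutelyContinuousOnInterval_integral {w : ℝ → Plane} {a b c : ℝ}
    (hw : ∀ x y, IntervalIntegrable w volume x y) :
    AbsolutelyContinuousOnInterval (fun x => ∫ t in c..x, w t) a b := by
  have key : ∀ i : Fin 2, AbsolutelyContinuousOnInterval
      (fun x => EuclideanSpace.single i (∫ t in a..x, w t i)) a b := fun i => by
    have hi : IntervalIntegrable (fun t => w t i) volume a b :=
      ⟨(EuclideanSpace.proj (𝕜 := ℝ) i).integrable_comp (hw a b).1,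
        (EuclideanSpace.proj (𝕜 := ℝ) i).integrable_comp (hw a b).2⟩
    refine (hi.absolutelyContinuousOnInterval_intervalIntegral left_mem_uIcc).of_dist_le (K := 1)
      fun x _ y _ => ?_
    rw [PiLp.dist_single_same, one_mul]
  refine ((key 0).fun_add (key 1)).of_dist_le (K := 1) fun x _ y _ => ?_
  have e : ∀ z, ∫ t in c..z, w t = (∫ t in c..a, w t) +
      (EuclideanSpace.single 0 (∫ t in a..z, w t 0) +
        EuclideanSpace.single 1 (∫ t in a..z, w t 1)) := by
    intro z
    rw [← intervalIntegral.integral_add_adjacent_intervals (hw c a) (hw a z)]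
    congr 1
    ext i
    rw [intervalIntegral_apply (hw a z)]
    fin_cases i <;> simp
  rw [e x, e y, dist_add_left, one_mul]

/-! ### Rotation by a right angle -/

theorem rot_apply_zero (v : Plane) : rot v 0 = -v 1 := rfl

theorem rot_apply_one (v : Plane) : rot v 1 = v 0 := rfl

/-- In the plane, a vector orthogonal to a unit vector is a multiple of its rotation. -/
theorem inner_rot_sq {v w : Plane} (hv : ‖v‖ = 1) (hvw : inner ℝ w v = 0) :
    inner ℝ w (rot v) ^ 2 = ‖w‖ ^ 2 := by
  have h1 : v 0 ^ 2 + v 1 ^ 2 = 1 := by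
    have := EuclideanSpace.real_norm_sq_eq v
    rw [hv, Fin.sum_univ_two] at this
    linarith
  rw [EuclideanSpace.real_norm_sq_eq]
  simp only [PiLp.inner_apply, Fin.sum_univ_two, rot_apply_zero, rot_apply_one,
    RCLike.inner_apply, conj_trivial] at hvw ⊢
  linear_combination (w 0 ^ 2 + w 1 ^ 2) * h1 - (v 0 * w 0 + v 1 * w 1) * hvw

/-! ### Least norm under weakly closed constraints -/

/-- In a Hilbert space, closed conditions on continuous linear images in the plane define a weakly
closed set, and such a set has an element of least norm as soon as it is nonempty. -/
theorem exists_min_norm_of_mem_closed {H ι : Type*} [NormedAddCommGroup H] [InnerProductSpace ℝ H]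
    [CompleteSpace H] (C : ι → H →L[ℝ] Plane) {K : ι → Set Plane} (hK : ∀ i, IsClosed (K i))
    (hne : ∃ u, ∀ i, C i u ∈ K i) :
    ∃ u, (∀ i, C i u ∈ K i) ∧ ∀ u', (∀ i, C i u' ∈ K i) → ‖u‖ ≤ ‖u'‖ := by
  obtain ⟨u₀, hu₀⟩ := hne
  -- The weak topology of `H` is realized as the weak-* topology of its dual through the Riesz map.
  let e : WeakDual ℝ H → H := fun l => (InnerProductSpace.toDual ℝ H).symm (WeakDual.toStrongDual l)
  have he : ∀ u, e (StrongDual.toWeakDual (InnerProductSpace.toDual ℝ H u)) = u := fun u => by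
    simp [e]
  have hnorm : ∀ l, ‖e l‖ = ‖WeakDual.toStrongDual l‖ := fun l =>
    (InnerProductSpace.toDual ℝ H).symm.norm_map _
  have hcont : ∀ i, Continuous fun l => C i (e l) := by
    intro i
    rw [← (EuclideanSpace.equiv (Fin 2) ℝ).comp_continuous_iff]
    refine continuous_pi fun j => ?_
    let φ : H →L[ℝ] ℝ := (EuclideanSpace.proj (𝕜 := ℝ) j).comp (C i)
    have : ∀ l, C i (e l) j = l ((InnerProductSpace.toDual ℝ H).symm φ) := by
      intro l
      have h1 : C i (e l) j = φ (e l) := rfl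
      rw [h1, ← InnerProductSpace.toDual_symm_apply (𝕜 := ℝ), real_inner_comm]
      exact InnerProductSpace.toDual_symm_apply
    change Continuous fun l => C i (e l) j
    simp_rw [this]
    exact WeakDual.eval_continuous _
  have hcl : IsClosed {l | ∀ i, C i (e l) ∈ K i} := by
    rw [ofPred_forall]
    exact isClosed_iInter fun i => (hK i).preimage (hcont i)
  have hcomp := (WeakDual.isCompact_closedBall (𝕜 := ℝ) (0 : StrongDual ℝ H) ‖u₀‖).inter_right hcl
  -- The norm is weakly lower semicontinuous because closed balls are weak-* closed.
  have hlsc : LowerSemicontinuous fun l => ‖e l‖ := by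
    rw [lowerSemicontinuous_iff_isClosed_preimage]
    intro r
    convert WeakDual.isClosed_closedBall (𝕜 := ℝ) (0 : StrongDual ℝ H) r using 1
    ext l
    simp [hnorm]
  have hmem : ∀ u, ‖u‖ ≤ ‖u₀‖ → (∀ i, C i u ∈ K i) →
      StrongDual.toWeakDual (InnerProductSpace.toDual ℝ H u) ∈
        WeakDual.toStrongDual ⁻¹' Metric.closedBall (0 : StrongDual ℝ H) ‖u₀‖ ∩
          {l | ∀ i, C i (e l) ∈ K i} := fun u hu hC =>
    ⟨by simpa using hu, fun i => by rw [he]; exact hC i⟩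
  obtain ⟨l, hl, hmin⟩ := (hlsc.lowerSemicontinuousOn _).exists_isMinOn
    ⟨_, hmem u₀ le_rfl hu₀⟩ hcomp
  refine ⟨e l, hl.2, fun u' hu' => ?_⟩
  rcases le_total ‖u'‖ ‖u₀‖ with h | h
  · have := hmin (hmem u' h hu')
    rw [mem_ofPred_eq] at this
    simpa only [he] using this
  · refine le_trans ?_ h
    have := hl.1
    rw [mem_preimage, mem_closedBall_zero_iff] at this
    rwa [hnorm]

/-! ### Tangents of closed curves of constant speed -/

/-- The restriction of Lebesgue measure to the unit interval. It lives on `Ioc 0 1`, to match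
interval integrals. -/
noncomputable abbrev unitVol : Measure ℝ := volume.restrict (Ioc 0 1)

/-- The pair `(v, u)` encodes the unit tangent `x ↦ v + ∫₀ˣ u` of a closed curve parametrized on
`[0, 1]` with constant speed: `v` is the initial tangent and `u` the derivative of the tangent. -/
structure IsTangentData (v : Plane) (u : ℝ → Plane) : Prop where
  memLp : MemLp u 2 unitVol
  norm_eq_one : ∀ x ∈ Icc (0 : ℝ) 1, ‖v + ∫ t in 0..x, u t‖ = 1
  integral_eq_zero : ∫ x in (0 : ℝ)..1, (v + ∫ t in 0..x, u t) = 0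

/-- Integration over `(0, x]` as a continuous linear map on `L²`, of norm at most one. For `x > 1`
the integral extends over `(0, 1]` only. -/
noncomputable def primitiveCLM (x : ℝ) : Lp Plane 2 unitVol →L[ℝ] Plane :=
  LinearMap.mkContinuous
    { toFun := fun u => ∫ t in Ioc 0 x, u t ∂unitVol
      map_add' := fun u w => by
        rw [← integral_add ((Lp.memLp u).integrable one_le_two).integrableOn
          ((Lp.memLp w).integrable one_le_two).integrableOn]
        exact integral_congr_ae (ae_restrict_of_ae (Lp.coeFn_add u w))
      map_smul' := fun c u => by
        rw [RingHom.id_apply, ← integral_smul]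
        exact integral_congr_ae (ae_restrict_of_ae (Lp.coeFn_smul c u)) } 1 fun u => by
    rw [one_mul]
    set p : Plane := ∫ t in Ioc 0 x, u t ∂unitVol with hp
    change ‖p‖ ≤ _
    -- Pairing the integral `p` with itself is pairing `u` with the function `p` on `(0, x]`.
    have h1 := L2.inner_indicatorConstLp_eq_inner_setIntegral (μ := unitVol) ℝ
      (measurableSet_Ioc (a := (0 : ℝ)) (b := x)) (measure_ne_top _ _) p u
    rw [← hp, real_inner_self_eq_norm_sq] at h1
    have h2 : ‖indicatorConstLp 2 (measurableSet_Ioc (a := (0 : ℝ)) (b := x))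
        (measure_ne_top unitVol _) p‖ ≤ ‖p‖ := by
      refine norm_indicatorConstLp_le.trans ?_
      refine mul_le_of_le_one_right (norm_nonneg _)
        (Real.rpow_le_one measureReal_nonneg ?_ (by norm_num))
      calc unitVol.real (Ioc 0 x) ≤ unitVol.real univ := measureReal_mono (subset_univ _)
        _ = 1 := by simp [Measure.real]
    have h3 := real_inner_le_norm (indicatorConstLp 2 (measurableSet_Ioc (a := (0 : ℝ)) (b := x))
        (measure_ne_top unitVol _) p) u
    rw [h1] at h3
    by_cases h0 : ‖p‖ = 0
    · rw [h0]; exact norm_nonneg _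
    · have : 0 < ‖p‖ := lt_of_le_of_ne (norm_nonneg _) (Ne.symm h0)
      nlinarith [mul_le_mul_of_nonneg_right h2 (norm_nonneg u)]

theorem norm_primitiveCLM_apply_le (x : ℝ) (u : Lp Plane 2 unitVol) :
    ‖primitiveCLM x u‖ ≤ ‖u‖ := by
  have := (primitiveCLM x).le_of_opNorm_le (LinearMap.mkContinuous_norm_le _ zero_le_one _) u
  rwa [one_mul] at this

theorem primitiveCLM_apply {x : ℝ} (hx : x ∈ Icc (0 : ℝ) 1) (u : Lp Plane 2 unitVol) :
    primitiveCLM x u = ∫ t in (0 : ℝ)..x, u t := by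
  change ∫ t in Ioc 0 x, u t ∂unitVol = _
  rw [intervalIntegral.integral_of_le hx.1, Measure.restrict_restrict measurableSet_Ioc,
    inter_eq_left.mpr (Ioc_subset_Ioc_right hx.2)]

theorem intervalIntegrable_of_memLp {u : ℝ → Plane} (hu : MemLp u 2 unitVol) :
    IntervalIntegrable u volume 0 1 :=
  (intervalIntegrable_iff_integrableOn_Ioc_of_le zero_le_one).mpr (hu.integrable one_le_two)

theorem intervalIntegrable_primitiveCLM (u : Lp Plane 2 unitVol) :
    IntervalIntegrable (fun x => primitiveCLM x u) volume 0 1 := by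
  refine ContinuousOn.intervalIntegrable ?_
  refine (intervalIntegral.continuousOn_primitive_interval'
    (intervalIntegrable_of_memLp (Lp.memLp u)) left_mem_uIcc).congr fun x hx => ?_
  rw [uIcc_of_le zero_le_one] at hx
  exact primitiveCLM_apply hx u

/-- The mean over `[0, 1]` of the primitive vanishing at `0`, as a continuous linear map on `L²`. -/
noncomputable def meanPrimitiveCLM : Lp Plane 2 unitVol →L[ℝ] Plane :=
  LinearMap.mkContinuous
    { toFun := fun u => ∫ x in (0 : ℝ)..1, primitiveCLM x u
      map_add' := fun u w => by
        simp only [map_add]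
        exact intervalIntegral.integral_add (intervalIntegrable_primitiveCLM u)
          (intervalIntegrable_primitiveCLM w)
      map_smul' := fun c u => by
        simp only [map_smul, intervalIntegral.integral_smul, RingHom.id_apply] } 1 fun u => by
    have := intervalIntegral.norm_integral_le_of_norm_le_const (a := 0) (b := 1)
      fun x _ => norm_primitiveCLM_apply_le x u
    simpa [mul_comm] using this

theorem meanPrimitiveCLM_apply (u : Lp Plane 2 unitVol) :
    meanPrimitiveCLM u = ∫ x in (0 : ℝ)..1, ∫ t in (0 : ℝ)..x, u t := by
  change ∫ x in (0 : ℝ)..1, primitiveCLM x u = _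
  refine intervalIntegral.integral_congr fun x hx => ?_
  rw [uIcc_of_le zero_le_one] at hx
  exact primitiveCLM_apply hx u

theorem norm_sq_eq_integral (u : Lp Plane 2 unitVol) :
    ‖u‖ ^ 2 = ∫ t in (0 : ℝ)..1, ‖u t‖ ^ 2 := by
  rw [← real_inner_self_eq_norm_sq, L2.inner_def, intervalIntegral.integral_of_le zero_le_one]
  simp only [real_inner_self_eq_norm_sq]

theorem integral_congr_of_ae_unitVol {u w : ℝ → Plane} (h : u =ᵐ[unitVol] w) {x : ℝ}
    (hx : x ∈ Icc (0 : ℝ) 1) : ∫ t in (0 : ℝ)..x, u t = ∫ t in (0 : ℝ)..x, w t := by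
  refine intervalIntegral.integral_congr_ae_restrict ?_
  rw [uIoc_of_le hx.1]
  exact ae_mono (Measure.restrict_mono (Ioc_subset_Ioc_right hx.2) le_rfl) h

namespace IsTangentData

variable {v : Plane} {u w : ℝ → Plane}

theorem continuousOn_tangent (h : IsTangentData v u) :
    ContinuousOn (fun x => v + ∫ t in (0 : ℝ)..x, u t) (Icc 0 1) := by
  have := intervalIntegral.continuousOn_primitive_interval'
    (intervalIntegrable_of_memLp h.memLp) left_mem_uIcc
  rw [uIcc_of_le zero_le_one] at this
  exact continuousOn_const.add this

theorem congr_ae (h : IsTangentData v u) (huw : w =ᵐ[unitVol] u) : IsTangentData v w where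
  memLp := (memLp_congr_ae huw).mpr h.memLp
  norm_eq_one x hx := by rw [integral_congr_of_ae_unitVol huw hx]; exact h.norm_eq_one x hx
  integral_eq_zero := by
    rw [← h.integral_eq_zero]
    refine intervalIntegral.integral_congr fun x hx => ?_
    rw [uIcc_of_le zero_le_one] at hx
    simp only [integral_congr_of_ae_unitVol huw hx]

/-- A nonconstant tangent is forced by closedness, so the bending energy is positive. -/
theorem integral_norm_sq_pos (h : IsTangentData v u) : 0 < ∫ t in (0 : ℝ)..1, ‖u t‖ ^ 2 := by
  have hint : IntegrableOn (fun t => ‖u t‖ ^ 2) (Ioc 0 1) := h.memLp.integrable_norm_pow two_ne_zero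
  refine lt_of_le_of_ne (intervalIntegral.integral_nonneg zero_le_one fun t _ => by positivity)
    fun h0 => ?_
  rw [intervalIntegral.integral_of_le zero_le_one, eq_comm,
    setIntegral_eq_zero_iff_of_nonneg_ae (ae_of_all _ fun t => by positivity) hint] at h0
  have h1 : u =ᵐ[unitVol] 0 := h0.mono fun t ht => by simpa using ht
  have h2 := h.congr_ae h1.symm
  have h3 := h2.norm_eq_one 0 (by simp)
  have h4 := h2.integral_eq_zero
  simp only [Pi.zero_apply, intervalIntegral.integral_zero, add_zero,
    intervalIntegral.integral_const, sub_zero, one_smul] at h3 h4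
  rw [h4, norm_zero] at h3
  exact zero_ne_one h3

end IsTangentData

/-- Closedness expresses the initial tangent through the derivative, so that tangent data are
described by conditions on continuous linear images of the derivative alone. -/
theorem isTangentData_coeFn_iff (v : Plane) (u : Lp Plane 2 unitVol) :
    IsTangentData v u ↔
      v = -meanPrimitiveCLM u ∧ ∀ x : Icc (0 : ℝ) 1, ‖v + primitiveCLM x u‖ = 1 := by
  have hmean : ∫ x in (0 : ℝ)..1, (v + ∫ t in (0 : ℝ)..x, u t) = v + meanPrimitiveCLM u := by
    rw [intervalIntegral.integral_add intervalIntegrable_const, meanPrimitiveCLM_apply]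
    · simp
    · refine (intervalIntegral.continuousOn_primitive_interval'
        (intervalIntegrable_of_memLp (Lp.memLp u)) left_mem_uIcc).intervalIntegrable
  constructor
  · intro h
    refine ⟨eq_neg_of_add_eq_zero_left (hmean ▸ h.integral_eq_zero), fun x => ?_⟩
    rw [primitiveCLM_apply x.2]
    exact h.norm_eq_one x x.2
  · rintro ⟨h1, h2⟩
    refine ⟨Lp.memLp u, fun x hx => ?_, ?_⟩
    · rw [← primitiveCLM_apply hx]
      exact h2 ⟨x, hx⟩
    · rw [hmean, h1, neg_add_cancel]

/-- The constraints are consistent: the tangent of a circle satisfies them. -/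
theorem exists_isTangentData : ∃ v u, IsTangentData v u := by
  let T : ℝ → Plane := fun x => !₂[Real.cos (2 * Real.pi * x), Real.sin (2 * Real.pi * x)]
  let u : ℝ → Plane := fun x =>
    !₂[-Real.sin (2 * Real.pi * x) * (2 * Real.pi), Real.cos (2 * Real.pi * x) * (2 * Real.pi)]
  have hcu : Continuous u := by
    refine (PiLp.continuous_toLp 2 _).comp (continuous_pi fun i => ?_)
    fin_cases i <;> simp <;> fun_prop
  have hcT : Continuous T := by
    refine (PiLp.continuous_toLp 2 _).comp (continuous_pi fun i => ?_)
    fin_cases i <;> simp <;> fun_prop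
  have hd : ∀ x, HasDerivAt T (u x) x := by
    intro x
    have h0 : HasDerivAt (fun x : ℝ => 2 * Real.pi * x) (2 * Real.pi) x := by
      simpa using (hasDerivAt_id x).const_mul (2 * Real.pi)
    have h1 : HasDerivAt (fun x => ![Real.cos (2 * Real.pi * x), Real.sin (2 * Real.pi * x)])
        ![-Real.sin (2 * Real.pi * x) * (2 * Real.pi),
          Real.cos (2 * Real.pi * x) * (2 * Real.pi)] x := by
      rw [hasDerivAt_pi]
      intro i
      fin_cases i
      · exact h0.cos
      · exact h0.sin
    exact (EuclideanSpace.equiv (Fin 2) ℝ).symm.hasFDerivAt.comp_hasDerivAt x h1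
  have hT : ∀ x, T 0 + ∫ t in (0 : ℝ)..x, u t = T x := fun x => by
    rw [intervalIntegral.integral_eq_sub_of_hasDerivAt (fun y _ => hd y)
      (hcu.intervalIntegrable _ _), add_sub_cancel]
  refine ⟨T 0, u, ?_, fun x _ => ?_, ?_⟩
  · obtain ⟨M, hM⟩ := isCompact_Icc.exists_bound_of_continuousOn
      (hcu.continuousOn (s := Icc (0 : ℝ) 1))
    exact MemLp.of_bound hcu.aestronglyMeasurable M
      (ae_restrict_of_forall_mem measurableSet_Ioc fun x hx => hM x (Ioc_subset_Icc_self hx))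
  · rw [hT]
    simp [T, EuclideanSpace.norm_eq, Fin.sum_univ_two]
  · simp_rw [hT]
    ext i
    rw [intervalIntegral_apply (hcT.intervalIntegrable _ _)]
    have h2 : (2 * Real.pi) ≠ 0 := by positivity
    fin_cases i <;> simp [T, h2, intervalIntegral.integral_comp_mul_left (fun x => Real.cos x),
      intervalIntegral.integral_comp_mul_left (fun x => Real.sin x)]

/-- Existence of tangent data of least bending energy, by the direct method: the
constraints are closed conditions on continuous linear images of the derivative. -/
theorem exists_minimal_isTangentData : ∃ v u, IsTangentData v u ∧
    ∀ v' u', IsTangentData v' u' →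
      ∫ t in (0 : ℝ)..1, ‖u t‖ ^ 2 ≤ ∫ t in (0 : ℝ)..1, ‖u' t‖ ^ 2 := by
  -- The tangent at `x`, with the initial value that makes its mean zero.
  let C : Icc (0 : ℝ) 1 → Lp Plane 2 unitVol →L[ℝ] Plane := fun x =>
    -meanPrimitiveCLM + primitiveCLM x
  have key : ∀ v u, IsTangentData v u → ∃ f : Lp Plane 2 unitVol,
      (∀ x, C x f ∈ Metric.sphere 0 1) ∧ f =ᵐ[unitVol] u := by
    intro v u h
    refine ⟨h.memLp.toLp u, fun x => ?_, h.memLp.coeFn_toLp⟩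
    obtain ⟨h1, h2⟩ := (isTangentData_coeFn_iff _ _).mp (h.congr_ae h.memLp.coeFn_toLp)
    simpa [C, ← h1] using h2 x
  obtain ⟨v₀, u₀, h₀⟩ := exists_isTangentData
  obtain ⟨f₀, hf₀, -⟩ := key v₀ u₀ h₀
  obtain ⟨f, hf, hmin⟩ :=
    exists_min_norm_of_mem_closed C (fun _ => Metric.isClosed_sphere) ⟨f₀, hf₀⟩
  refine ⟨-meanPrimitiveCLM f, f, (isTangentData_coeFn_iff _ _).mpr ⟨rfl, fun x => ?_⟩, ?_⟩
  · simpa [C] using hf x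
  · intro v' u' h'
    obtain ⟨f', hf', he⟩ := key v' u' h'
    have h1 : ∫ t in (0 : ℝ)..1, ‖u' t‖ ^ 2 = ∫ t in (0 : ℝ)..1, ‖f' t‖ ^ 2 := by
      refine intervalIntegral.integral_congr_ae_restrict ?_
      rw [uIoc_of_le zero_le_one]
      exact he.mono fun t ht => by simp only [ht]
    rw [h1, ← norm_sq_eq_integral, ← norm_sq_eq_integral]
    exact pow_le_pow_left₀ (norm_nonneg _) (hmin f' hf') 2

/-! ### The energy density -/

/-- The integrand of the energy, written with unrestricted derivatives. It depends only on the germ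
of the curve, hence does not see the interval on which the curve is considered. -/
noncomputable def energyDensity (f : ℝ → Plane) (x : ℝ) : ℝ :=
  (inner ℝ (‖deriv f x‖⁻¹ • deriv (fun y => ‖deriv f y‖⁻¹ • deriv f y) x)
    (rot (‖deriv f x‖⁻¹ • deriv f x)) ^ 2 + 1) * ‖deriv f x‖

/-- The unit tangent of a curve on `[a, b]`. -/
noncomputable def unitTangentOn (a b : ℝ) (f : ℝ → Plane) (x : ℝ) : Plane :=
  ‖dx a b f x‖⁻¹ • dx a b f x

theorem dx_eq_deriv {a b x : ℝ} (f : ℝ → Plane) (hx : x ∈ Ioo a b) : dx a b f x = deriv f x :=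
  derivWithin_of_mem_nhds (Icc_mem_nhds hx.1 hx.2)

theorem unitTangentOn_eventuallyEq {a b x : ℝ} (f : ℝ → Plane) (hx : x ∈ Ioo a b) :
    unitTangentOn a b f =ᶠ[nhds x] fun y => ‖deriv f y‖⁻¹ • deriv f y := by
  filter_upwards [isOpen_Ioo.mem_nhds hx] with y hy
  rw [unitTangentOn, dx_eq_deriv f hy]

theorem energyDensity_eq {a b x : ℝ} (f : ℝ → Plane) (hx : x ∈ Ioo a b) :
    energyDensity f x = (inner ℝ (‖dx a b f x‖⁻¹ • deriv (unitTangentOn a b f) x)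
      (rot (unitTangentOn a b f x)) ^ 2 + 1) * ‖dx a b f x‖ := by
  have h := unitTangentOn_eventuallyEq f hx
  rw [h.deriv_eq, h.eq_of_nhds, dx_eq_deriv f hx, energyDensity]

theorem ae_mem_Ioo (a b : ℝ) : ∀ᵐ x ∂volume.restrict (uIoc a b), x ∈ Ioo (min a b) (max a b) := by
  rw [uIoc, ← Measure.restrict_congr_set Ioo_ae_eq_Ioc]
  exact ae_restrict_mem measurableSet_Ioo

theorem energy_eq_integral_energyDensity (f : ℝ → Plane) :
    energy f = ∫ x in (0 : ℝ)..1, energyDensity f x := by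
  refine intervalIntegral.integral_congr_ae_restrict ?_
  filter_upwards [ae_mem_Ioo 0 1] with x hx
  rw [min_eq_left zero_le_one, max_eq_right zero_le_one] at hx
  rw [energyDensity_eq f hx, ← dx_eq_deriv _ hx]
  rfl

/-! ### The unit tangent of a regular `H²` curve -/

/-- Normalization of vectors is Lipschitz away from the origin. -/
theorem dist_inv_norm_smul_le {p q : Plane} {δ : ℝ} (hδ : 0 < δ) (hp : δ ≤ ‖p‖) (hq : δ ≤ ‖q‖) :
    dist (‖p‖⁻¹ • p) (‖q‖⁻¹ • q) ≤ 2 / δ * dist p q := by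
  have hp' := hδ.trans_le hp
  have hq' := hδ.trans_le hq
  rw [dist_eq_norm, dist_eq_norm]
  have h1 : ‖p‖⁻¹ • p - ‖q‖⁻¹ • q = ‖p‖⁻¹ • (p - q) + (‖p‖⁻¹ - ‖q‖⁻¹) • q := by module
  have h2 : ‖(‖p‖⁻¹ - ‖q‖⁻¹) • q‖ ≤ ‖p‖⁻¹ * ‖p - q‖ := by
    have h3 : ‖p‖⁻¹ - ‖q‖⁻¹ = ‖p‖⁻¹ * ‖q‖⁻¹ * (‖q‖ - ‖p‖) := by field_simp
    rw [norm_smul, h3, norm_mul, Real.norm_of_nonneg (by positivity), Real.norm_eq_abs]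
    have h4 := abs_norm_sub_norm_le q p
    rw [norm_sub_rev] at h4
    calc ‖p‖⁻¹ * ‖q‖⁻¹ * |‖q‖ - ‖p‖| * ‖q‖ = ‖p‖⁻¹ * |‖q‖ - ‖p‖| := by field_simp
      _ ≤ _ := by gcongr
  have h5 : ‖p‖⁻¹ ≤ δ⁻¹ := inv_anti₀ hδ hp
  rw [h1]
  calc _ ≤ ‖‖p‖⁻¹ • (p - q)‖ + ‖(‖p‖⁻¹ - ‖q‖⁻¹) • q‖ := norm_add_le _ _
    _ ≤ ‖p‖⁻¹ * ‖p - q‖ + ‖p‖⁻¹ * ‖p - q‖ := by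
      gcongr
      rw [norm_smul, norm_inv, norm_norm]
    _ ≤ δ⁻¹ * ‖p - q‖ + δ⁻¹ * ‖p - q‖ := by gcongr
    _ = _ := by ring

/-- Where `f` is not differentiable its `deriv` is zero, so only `g` has to be differentiable. -/
theorem norm_deriv_le_mul_norm_of_dist_le {f g : ℝ → Plane} {g' : Plane} {x K : ℝ} (hK : 0 ≤ K)
    (hg : HasDerivAt g g' x)
    (h : ∀ᶠ y in nhds x, dist (f y) (f x) ≤ K * dist (g y) (g x)) : ‖deriv f x‖ ≤ K * ‖g'‖ := by
  by_cases hf : DifferentiableAt ℝ f x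
  · refine le_of_tendsto_of_tendsto (hasDerivAt_iff_tendsto_slope.mp hf.hasDerivAt).norm
      ((hasDerivAt_iff_tendsto_slope.mp hg).norm.const_mul K) ?_
    filter_upwards [h.filter_mono nhdsWithin_le_nhds] with y hy
    rw [dist_eq_norm, dist_eq_norm] at hy
    simp only [slope_def_module, norm_smul]
    calc _ ≤ ‖(y - x)⁻¹‖ * (K * ‖g y - g x‖) := by gcongr
      _ = _ := by ring
  · rw [deriv_zero_of_not_differentiableAt hf, norm_zero]
    positivity

namespace IsRegularH2On

variable {f : ℝ → Plane} {a b : ℝ}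

theorem continuousOn_dx (h : IsRegularH2On f a b) (hab : a < b) :
    ContinuousOn (dx a b f) (Icc a b) :=
  h.isH2On.contDiffOn.continuousOn_derivWithin (uniqueDiffOn_Icc hab) le_rfl

theorem exists_le_norm_dx (h : IsRegularH2On f a b) (hab : a < b) :
    ∃ δ > 0, ∀ x ∈ Icc a b, δ ≤ ‖dx a b f x‖ := by
  obtain ⟨x, hx, hmin⟩ := isCompact_Icc.exists_isMinOn (nonempty_Icc.mpr hab.le)
    (h.continuousOn_dx hab).norm
  exact ⟨_, norm_pos_iff.mpr (h.regular x hx), fun y hy => hmin hy⟩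

theorem norm_unitTangentOn (h : IsRegularH2On f a b) {x : ℝ} (hx : x ∈ Icc a b) :
    ‖unitTangentOn a b f x‖ = 1 :=
  norm_smul_inv_norm (𝕜 := ℝ) (h.regular x hx)

theorem exists_dist_unitTangentOn_le (h : IsRegularH2On f a b) (hab : a < b) :
    ∃ K, 0 ≤ K ∧ ∀ x ∈ Icc a b, ∀ y ∈ Icc a b,
      dist (unitTangentOn a b f x) (unitTangentOn a b f y) ≤
        K * dist (dx a b f x) (dx a b f y) := by
  obtain ⟨δ, hδ, hle⟩ := h.exists_le_norm_dx hab
  exact ⟨2 / δ, by positivity, fun x hx y hy => dist_inv_norm_smul_le hδ (hle x hx) (hle y hy)⟩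

theorem absolutelyContinuous_unitTangentOn (h : IsRegularH2On f a b) (hab : a < b) :
    AbsolutelyContinuousOnInterval (unitTangentOn a b f) a b := by
  obtain ⟨K, -, hK⟩ := h.exists_dist_unitTangentOn_le hab
  rw [← uIcc_of_le hab.le] at hK
  exact h.isH2On.absolutelyContinuous.of_dist_le hK

theorem memLp_deriv_unitTangentOn (h : IsRegularH2On f a b) (hab : a < b) :
    MemLp (deriv (unitTangentOn a b f)) 2 (volume.restrict (Icc a b)) := by
  obtain ⟨K, hK0, hK⟩ := h.exists_dist_unitTangentOn_le hab
  refine h.isH2On.memLp.of_le_mul (c := K) (stronglyMeasurable_deriv _).aestronglyMeasurable ?_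
  have hd := h.isH2On.absolutelyContinuous.boundedVariationOn.ae_differentiableAt_of_mem_uIcc
  rw [← Measure.restrict_congr_set Ioo_ae_eq_Icc, ae_restrict_iff' measurableSet_Ioo]
  filter_upwards [hd] with x hx hxm
  rw [dx_eq_deriv (dx a b f) hxm]
  refine norm_deriv_le_mul_norm_of_dist_le hK0
    (hx (by rw [uIcc_of_le hab.le]; exact Ioo_subset_Icc_self hxm)).hasDerivAt ?_
  filter_upwards [isOpen_Ioo.mem_nhds hxm] with y hy
  exact hK y (Ioo_subset_Icc_self hy) x (Ioo_subset_Icc_self hxm)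

/-- This holds at every interior point, because `deriv` vanishes where the derivative does not
exist. -/
theorem inner_deriv_unitTangentOn (h : IsRegularH2On f a b) {x : ℝ} (hx : x ∈ Ioo a b) :
    inner ℝ (deriv (unitTangentOn a b f) x) (unitTangentOn a b f x) = 0 := by
  by_cases hd : DifferentiableAt ℝ (unitTangentOn a b f) x
  · have h1 := hd.hasDerivAt.norm_sq
    have h2 : (fun y => ‖unitTangentOn a b f y‖ ^ 2) =ᶠ[nhds x] fun _ => (1 : ℝ) := by
      filter_upwards [isOpen_Ioo.mem_nhds hx] with y hy
      rw [h.norm_unitTangentOn (Ioo_subset_Icc_self hy), one_pow]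
    have h3 := (h1.congr_of_eventuallyEq h2.symm).unique (hasDerivAt_const x (1 : ℝ))
    rw [real_inner_comm]
    linarith
  · rw [deriv_zero_of_not_differentiableAt hd, inner_zero_left]

/-- As the derivative of the unit tangent is normal to the curve, the squared curvature is the
squared length of the arclength derivative of the tangent. -/
theorem energyDensity_eq (h : IsRegularH2On f a b) {x : ℝ} (hx : x ∈ Ioo a b) :
    energyDensity f x =
      ‖dx a b f x‖⁻¹ * ‖deriv (unitTangentOn a b f) x‖ ^ 2 + ‖dx a b f x‖ := by
  have hx' := Ioo_subset_Icc_self hx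
  have h0 : ‖dx a b f x‖ ≠ 0 := norm_ne_zero_iff.mpr (h.regular x hx')
  rw [ElasticDrop.energyDensity_eq f hx, inner_rot_sq (h.norm_unitTangentOn hx'), norm_smul,
    norm_inv, norm_norm]
  · field_simp
  · rw [real_inner_smul_left, h.inner_deriv_unitTangentOn hx, mul_zero]

theorem intervalIntegrable_bending (h : IsRegularH2On f a b) (hab : a < b) :
    IntervalIntegrable (fun x => ‖dx a b f x‖⁻¹ * ‖deriv (unitTangentOn a b f) x‖ ^ 2)
      volume a b := by
  have h1 : IntegrableOn (fun x => ‖deriv (unitTangentOn a b f) x‖ ^ 2) (Icc a b) :=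
    (h.memLp_deriv_unitTangentOn hab).integrable_norm_pow two_ne_zero
  rw [intervalIntegrable_iff_integrableOn_Icc_of_le hab.le]
  exact h1.continuousOn_mul ((h.continuousOn_dx hab).norm.inv₀ fun x hx =>
    norm_ne_zero_iff.mpr (h.regular x hx)) isCompact_Icc

theorem intervalIntegrable_norm_dx (h : IsRegularH2On f a b) (hab : a < b) :
    IntervalIntegrable (fun x => ‖dx a b f x‖) volume a b := by
  refine ContinuousOn.intervalIntegrable ?_
  rw [uIcc_of_le hab.le]
  exact (h.continuousOn_dx hab).norm

theorem energyDensity_ae_eq (h : IsRegularH2On f a b) (hab : a < b) :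
    energyDensity f =ᵐ[volume.restrict (uIoc a b)]
      fun x => ‖dx a b f x‖⁻¹ * ‖deriv (unitTangentOn a b f) x‖ ^ 2 + ‖dx a b f x‖ := by
  filter_upwards [ae_mem_Ioo a b] with x hx
  rw [min_eq_left hab.le, max_eq_right hab.le] at hx
  exact h.energyDensity_eq hx

theorem intervalIntegrable_energyDensity (h : IsRegularH2On f a b) (hab : a < b) :
    IntervalIntegrable (energyDensity f) volume a b :=
  ((h.intervalIntegrable_bending hab).add (h.intervalIntegrable_norm_dx hab)).congr_ae
    (h.energyDensity_ae_eq hab).symm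

theorem integral_dx (h : IsRegularH2On f a b) (hab : a < b) :
    ∫ x in a..b, dx a b f x = f b - f a := by
  refine intervalIntegral.integral_eq_sub_of_hasDerivAt_of_le hab.le
    h.isH2On.contDiffOn.continuousOn (fun x hx => ?_) ?_
  · rw [dx_eq_deriv f hx]
    exact ((h.isH2On.contDiffOn.differentiableOn one_ne_zero).differentiableAt
      (Icc_mem_nhds hx.1 hx.2)).hasDerivAt
  · refine ContinuousOn.intervalIntegrable ?_
    rw [uIcc_of_le hab.le]
    exact h.continuousOn_dx hab

end IsRegularH2On

/-! ### Arclength parametrization and the lower bound -/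

/-- Change of variables along a function with positive derivative. No regularity of `F` is needed,
which allows integrands that are only defined almost everywhere. -/
theorem integral_image_of_strictMono {E : Type*} [NormedAddCommGroup E] [NormedSpace ℝ E]
    {s s' : ℝ → ℝ} (hs : StrictMono s) (hd : ∀ x, HasDerivAt s (s' x) x) (hpos : ∀ x, 0 < s' x)
    {a b : ℝ} (hab : a ≤ b) (F : ℝ → E) :
    (IntegrableOn F (Icc (s a) (s b)) ↔ IntegrableOn (fun t => s' t • F (s t)) (Icc a b)) ∧
    ∫ y in (s a)..(s b), F y = ∫ t in a..b, s' t • F (s t) := by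
  have himg : s '' Icc a b = Icc (s a) (s b) := by
    refine Subset.antisymm ?_ ?_
    · rintro _ ⟨x, hx, rfl⟩
      exact ⟨hs.monotone hx.1, hs.monotone hx.2⟩
    · exact intermediate_value_Icc hab
        (continuous_iff_continuousAt.mpr fun x => (hd x).continuousAt).continuousOn
  have h1 := integrableOn_image_iff_integrableOn_abs_deriv_smul
    (measurableSet_Icc (a := a) (b := b))
    (fun x _ => (hd x).hasDerivWithinAt) hs.injective.injOn F
  have h2 := integral_image_eq_integral_abs_deriv_smul (measurableSet_Icc (a := a) (b := b))
    (fun x _ => (hd x).hasDerivWithinAt) hs.injective.injOn F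
  simp only [abs_of_pos (hpos _), himg] at h1 h2
  refine ⟨h1, ?_⟩
  rw [intervalIntegral.integral_of_le hab, intervalIntegral.integral_of_le (hs.monotone hab),
    ← integral_Icc_eq_integral_Ioc, ← integral_Icc_eq_integral_Ioc, h2]

/-- Reparametrizing a closed curve proportionally to arclength turns its unit tangent into tangent
data `(v, u)` such that the product of the length and the bending energy of the curve is
`∫ ‖u‖²`. -/
theorem IsRegularH2On.exists_isTangentData {f : ℝ → Plane} {a b : ℝ} (h : IsRegularH2On f a b)
    (hab : a < b) (hclosed : f a = f b) :
    ∃ v u, IsTangentData v u ∧ ∫ t in (0 : ℝ)..1, ‖u t‖ ^ 2 = (∫ x in a..b, ‖dx a b f x‖) *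
      ∫ x in a..b, ‖dx a b f x‖⁻¹ * ‖deriv (unitTangentOn a b f) x‖ ^ 2 := by
  set τ := unitTangentOn a b f with hτ
  -- The speed, extended to a positive continuous function on the line.
  let n : ℝ → ℝ := IccExtend hab.le fun x => ‖dx a b f x‖
  have hn : ∀ x ∈ Icc a b, n x = ‖dx a b f x‖ := fun x hx => IccExtend_of_mem hab.le _ hx
  have hnc : Continuous n :=
    (continuousOn_iff_continuous_domRestrict.mp (h.continuousOn_dx hab).norm).Icc_extend'
  have hnpos : ∀ x, 0 < n x := fun x => norm_pos_iff.mpr (h.regular _ (projIcc a b hab.le x).2)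
  set L := ∫ x in a..b, ‖dx a b f x‖ with hL
  have hnL : ∫ x in a..b, n x = L := intervalIntegral.integral_congr fun x hx => by
    rw [uIcc_of_le hab.le] at hx
    exact hn x hx
  have hLpos : 0 < L := by
    rw [← hnL]
    exact intervalIntegral.intervalIntegral_pos_of_pos (hnc.intervalIntegrable _ _) hnpos hab
  -- The normalized arclength, an increasing `C¹` bijection of `[a, b]` onto `[0, 1]`.
  let s : ℝ → ℝ := fun x => L⁻¹ * ∫ t in a..x, n t
  have hspos : ∀ x, 0 < L⁻¹ * n x := fun x => mul_pos (inv_pos.mpr hLpos) (hnpos x)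
  have hsd : ∀ x, HasDerivAt s (L⁻¹ * n x) x := fun x =>
    (hnc.integral_hasStrictDerivAt a x).hasDerivAt.const_mul _
  have hsm : StrictMono s := strictMono_of_deriv_pos fun x => by
    rw [(hsd x).deriv]
    exact hspos x
  have hsa : s a = 0 := by simp [s]
  have hsb : s b = 1 := by simp only [s, hnL]; exact inv_mul_cancel₀ hLpos.ne'
  have cov := fun {E : Type} [NormedAddCommGroup E] [NormedSpace ℝ E] (F : ℝ → E) {x : ℝ}
    (hx : a ≤ x) => integral_image_of_strictMono hsm hsd hspos hx F
  -- The derivative of the unit tangent with respect to the normalized arclength.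
  let u : ℝ → Plane := fun y => (L / n (Function.invFun s y)) • deriv τ (Function.invFun s y)
  have hus : ∀ t, u (s t) = (L / n t) • deriv τ t := fun t => by
    simp only [u, Function.leftInverse_invFun hsm.injective t]
  have hu1 : ∀ t, (L⁻¹ * n t) • u (s t) = deriv τ t := fun t => by
    rw [hus, smul_smul]
    have := (hnpos t).ne'
    have := hLpos.ne'
    rw [show L⁻¹ * n t * (L / n t) = 1 by field_simp, one_smul]
  have hu2 : ∀ t, (L⁻¹ * n t) • ‖u (s t)‖ ^ 2 = L * ((n t)⁻¹ * ‖deriv τ t‖ ^ 2) := fun t => by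
    rw [hus, norm_smul, Real.norm_of_nonneg (div_pos hLpos (hnpos t)).le, smul_eq_mul]
    have := (hnpos t).ne'
    field_simp
  have hτint : IntegrableOn (deriv τ) (Icc a b) :=
    (h.memLp_deriv_unitTangentOn hab).integrable one_le_two
  have hprim : ∀ x ∈ Icc a b, τ a + ∫ t in (0 : ℝ)..(s x), u t = τ x := by
    intro x hx
    have hsub : uIcc a x ⊆ uIcc a b := by
      rw [uIcc_of_le hx.1, uIcc_of_le hab.le]
      exact Icc_subset_Icc_right hx.2
    rw [← hsa, (cov u hx.1).2, intervalIntegral.integral_congr fun t _ => hu1 t,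
      integral_deriv_eq_sub_of_absolutelyContinuous
        ((h.absolutelyContinuous_unitTangentOn hab).mono hsub), add_sub_cancel]
    rw [intervalIntegrable_iff_integrableOn_Icc_of_le hx.1]
    exact hτint.mono_set (Icc_subset_Icc_right hx.2)
  have hsq : ∀ x ∈ Icc a b, L * ((n x)⁻¹ * ‖deriv τ x‖ ^ 2) =
      L * (‖dx a b f x‖⁻¹ * ‖deriv τ x‖ ^ 2) := fun x hx => by rw [hn x hx]
  refine ⟨τ a, u, ⟨?_, ?_, ?_⟩, ?_⟩
  · rw [unitVol, Measure.restrict_congr_set (Ioc_ae_eq_Icc (μ := (volume : Measure ℝ)))]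
    have hi1 : IntegrableOn u (Icc 0 1) := by
      rw [← hsa, ← hsb, (cov u hab.le).1]
      simpa only [hu1] using hτint
    refine (memLp_two_iff_integrable_sq_norm hi1.aestronglyMeasurable).mpr ?_
    change IntegrableOn (fun y => ‖u y‖ ^ 2) (Icc 0 1)
    rw [← hsa, ← hsb, (cov (fun y => ‖u y‖ ^ 2) hab.le).1]
    simp only [hu2]
    refine IntegrableOn.congr_fun ?_ (fun x hx => (hsq x hx).symm) measurableSet_Icc
    exact ((intervalIntegrable_iff_integrableOn_Icc_of_le hab.le).mp
      (h.intervalIntegrable_bending hab)).const_mul L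
  · intro y hy
    rw [← hsa, ← hsb] at hy
    obtain ⟨x, hx, rfl⟩ := intermediate_value_Icc hab.le
      (continuous_iff_continuousAt.mpr fun x => (hsd x).continuousAt).continuousOn hy
    rw [hprim x hx]
    exact h.norm_unitTangentOn hx
  · have h1 := (cov (fun y => τ a + ∫ t in (0 : ℝ)..y, u t) hab.le).2
    rw [hsa, hsb] at h1
    rw [h1, intervalIntegral.integral_congr (g := fun x => L⁻¹ • dx a b f x) fun x hx => ?_,
      intervalIntegral.integral_smul, h.integral_dx hab, hclosed, sub_self, smul_zero]
    rw [uIcc_of_le hab.le] at hx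
    have h0 : ‖dx a b f x‖ ≠ 0 := norm_ne_zero_iff.mpr (h.regular x hx)
    simp only [hprim x hx, hn x hx]
    rw [hτ, unitTangentOn, smul_smul, mul_assoc, mul_inv_cancel₀ h0, mul_one]
  · have h1 := (cov (fun y => ‖u y‖ ^ 2) hab.le).2
    rw [hsa, hsb] at h1
    rw [h1, ← intervalIntegral.integral_const_mul]
    refine intervalIntegral.integral_congr fun x hx => ?_
    rw [uIcc_of_le hab.le] at hx
    simp only [hu2, hsq x hx]

/-- The energy `B + L` of a closed arc is at least `2 √(L B)` by the inequality of arithmetic and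
geometric means. -/
theorem IsRegularH2On.two_sqrt_le_integral_energyDensity {f : ℝ → Plane} {a b μ : ℝ}
    (h : IsRegularH2On f a b) (hab : a < b) (hclosed : f a = f b)
    (hμ : ∀ v u, IsTangentData v u → μ ≤ ∫ t in (0 : ℝ)..1, ‖u t‖ ^ 2) :
    2 * √μ ≤ ∫ x in a..b, energyDensity f x := by
  obtain ⟨v, u, hu, he⟩ := h.exists_isTangentData hab hclosed
  rw [intervalIntegral.integral_congr_ae_restrict (h.energyDensity_ae_eq hab),
    intervalIntegral.integral_add (h.intervalIntegrable_bending hab)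
      (h.intervalIntegrable_norm_dx hab)]
  have h1 := hμ v u hu
  rw [he] at h1
  have hB : 0 ≤ ∫ x in a..b, ‖dx a b f x‖⁻¹ * ‖deriv (unitTangentOn a b f) x‖ ^ 2 :=
    intervalIntegral.integral_nonneg hab.le fun _ _ => by positivity
  have hL : 0 ≤ ∫ x in a..b, ‖dx a b f x‖ :=
    intervalIntegral.integral_nonneg hab.le fun _ _ => by positivity
  generalize (∫ x in a..b, ‖dx a b f x‖⁻¹ * ‖deriv (unitTangentOn a b f) x‖ ^ 2) = B at *
  generalize (∫ x in a..b, ‖dx a b f x‖) = L at *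
  have h2 : √μ ≤ (B + L) / 2 :=
    Real.sqrt_le_iff.mpr ⟨by positivity, by nlinarith [sq_nonneg (B - L)]⟩
  linarith

/-! ### Curves of constant speed -/

/-- The curve starting at the origin with derivative `c (v + ∫₀ˣ w)`: the curve of constant speed
`c` whose unit tangent has initial value `v` and derivative `w`. -/
noncomputable def curveOfTangent (c : ℝ) (v : Plane) (w : ℝ → Plane) (x : ℝ) : Plane :=
  ∫ y in (0 : ℝ)..x, c • (v + ∫ t in (0 : ℝ)..y, w t)

section curveOfTangent

variable {c : ℝ} {v : Plane} {w : ℝ → Plane}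

theorem intervalIntegrable_of_forall_memLp (hw : ∀ a b, MemLp w 2 (volume.restrict (Icc a b)))
    (a b : ℝ) : IntervalIntegrable w volume a b := by
  have h := (hw (min a b) (max a b)).integrable one_le_two
  exact IntegrableOn.intervalIntegrable h

theorem continuous_tangent
    (hw : ∀ a b, MemLp w 2 (volume.restrict (Icc a b))) :
    Continuous fun x => v + ∫ t in (0 : ℝ)..x, w t :=
  continuous_const.add
    (intervalIntegral.continuous_primitive (intervalIntegrable_of_forall_memLp hw) 0)

theorem hasDerivAt_curveOfTangent
    (hw : ∀ a b, MemLp w 2 (volume.restrict (Icc a b))) (x : ℝ) :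
    HasDerivAt (curveOfTangent c v w) (c • (v + ∫ t in (0 : ℝ)..x, w t)) x :=
  (((continuous_tangent hw).const_smul c).integral_hasStrictDerivAt 0 x).hasDerivAt

theorem dx_curveOfTangent
    (hw : ∀ a b, MemLp w 2 (volume.restrict (Icc a b)))
    {a b x : ℝ} (hab : a < b) (hx : x ∈ Icc a b) :
    dx a b (curveOfTangent c v w) x = c • (v + ∫ t in (0 : ℝ)..x, w t) :=
  (hasDerivAt_curveOfTangent hw x).hasDerivWithinAt.derivWithin (uniqueDiffOn_Icc hab x hx)

theorem ae_hasDerivAt_tangent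
    (hw : ∀ a b, MemLp w 2 (volume.restrict (Icc a b))) :
    ∀ᵐ x, HasDerivAt (fun x => v + ∫ t in (0 : ℝ)..x, w t) (w x) x := by
  have hloc : LocallyIntegrable w := by
    refine locallyIntegrable_iff.mpr fun k hk => ?_
    obtain ⟨M, hM⟩ := hk.isBounded.subset_closedBall 0
    rw [Real.closedBall_eq_Icc] at hM
    have : IntegrableOn w (Icc (0 - M) (0 + M)) := (hw _ _).integrable one_le_two
    exact this.mono_set hM
  filter_upwards [LocallyIntegrable.ae_hasDerivAt_integral hloc] with x hx
  exact (hx 0).const_add v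

theorem isRegularH2On_curveOfTangent
    (hw : ∀ a b, MemLp w 2 (volume.restrict (Icc a b))) (hc : 0 < c) {a b : ℝ} (hab : a < b)
    (hv : ∀ x ∈ Icc a b, ‖v + ∫ t in (0 : ℝ)..x, w t‖ = 1) :
    IsRegularH2On (curveOfTangent c v w) a b where
  isH2On := by
    refine ⟨?_, ?_, ?_⟩
    · refine ContDiff.contDiffOn (contDiff_one_iff_deriv.mpr
        ⟨fun x => (hasDerivAt_curveOfTangent hw x).differentiableAt, ?_⟩)
      rw [show deriv (curveOfTangent c v w) = _ from
        funext fun x => (hasDerivAt_curveOfTangent hw x).deriv]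
      exact (continuous_tangent hw).const_smul c
    · refine (absolutelyContinuousOnInterval_integral (c := 0)
        (intervalIntegrable_of_forall_memLp hw)).of_dist_le (K := ‖c‖) fun x hx y hy => ?_
      rw [uIcc_of_le hab.le] at hx hy
      rw [dx_curveOfTangent hw hab hx, dx_curveOfTangent hw hab hy, dist_smul₀, dist_add_left]
    · refine (memLp_congr_ae ?_).mpr ((hw a b).const_smul c)
      refine (ae_restrict_iff' measurableSet_Icc).mpr ?_
      filter_upwards [ae_hasDerivAt_tangent (v := v) hw] with x hx hxm
      have h1 : dx a b (dx a b (curveOfTangent c v w)) x =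
          derivWithin (fun x => c • (v + ∫ t in (0 : ℝ)..x, w t)) (Icc a b) x :=
        derivWithin_congr (fun y hy => dx_curveOfTangent hw hab hy) (dx_curveOfTangent hw hab hxm)
      rw [h1]
      exact (hx.const_smul c).hasDerivWithinAt.derivWithin (uniqueDiffOn_Icc hab x hxm)
  regular x hx := by
    rw [dx_curveOfTangent hw hab hx, ← norm_pos_iff, norm_smul, hv x hx, mul_one]
    exact norm_pos_iff.mpr hc.ne'

/-- The tangent is the normalized velocity, so the squared curvature is `c⁻² ‖w‖²`. -/
theorem energy_curveOfTangent
    (hw : ∀ a b, MemLp w 2 (volume.restrict (Icc a b))) (hc : 0 < c)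
    (hv : ∀ x ∈ Icc (0 : ℝ) 1, ‖v + ∫ t in (0 : ℝ)..x, w t‖ = 1) :
    energy (curveOfTangent c v w) = c + c⁻¹ * ∫ t in (0 : ℝ)..1, ‖w t‖ ^ 2 := by
  have hreg := isRegularH2On_curveOfTangent hw hc zero_lt_one hv
  have hsq : IntervalIntegrable (fun x => ‖w x‖ ^ 2) volume 0 1 := by
    rw [intervalIntegrable_iff_integrableOn_Icc_of_le zero_le_one]
    exact (hw 0 1).integrable_norm_pow two_ne_zero
  have htan : ∀ x ∈ Icc (0 : ℝ) 1,
      unitTangentOn 0 1 (curveOfTangent c v w) x = v + ∫ t in (0 : ℝ)..x, w t := by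
    intro x hx
    rw [unitTangentOn, dx_curveOfTangent hw zero_lt_one hx, norm_smul, hv x hx, mul_one,
      Real.norm_of_nonneg hc.le, smul_smul, inv_mul_cancel₀ hc.ne', one_smul]
  have hae : energyDensity (curveOfTangent c v w) =ᵐ[volume.restrict (uIoc 0 1)]
      fun x => c⁻¹ * ‖w x‖ ^ 2 + c := by
    filter_upwards [ae_mem_Ioo 0 1, ae_restrict_of_ae (ae_hasDerivAt_tangent (v := v) hw)]
      with x hx hd
    rw [min_eq_left zero_le_one, max_eq_right zero_le_one] at hx
    have h1 : unitTangentOn 0 1 (curveOfTangent c v w) =ᶠ[nhds x]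
        fun x => v + ∫ t in (0 : ℝ)..x, w t := by
      filter_upwards [isOpen_Ioo.mem_nhds hx] with y hy
      exact htan y (Ioo_subset_Icc_self hy)
    rw [hreg.energyDensity_eq hx, h1.deriv_eq, hd.deriv,
      dx_curveOfTangent hw zero_lt_one (Ioo_subset_Icc_self hx), norm_smul,
      hv x (Ioo_subset_Icc_self hx), mul_one, Real.norm_of_nonneg hc.le]
  rw [energy_eq_integral_energyDensity, intervalIntegral.integral_congr_ae_restrict hae,
    intervalIntegral.integral_add (hsq.const_mul _) intervalIntegrable_const,
    intervalIntegral.integral_const_mul, intervalIntegral.integral_const, sub_zero, one_smul,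
    add_comm]

end curveOfTangent

/-! ### Traversing an interval forth and back -/

section fold

variable {E F : Type*}

/-- The `1`-periodic function whose first half period runs through the values of `A` on `[0, 1]`
and whose second half runs backwards through the values of `B` on `(0, 1)`, both at double speed. -/
noncomputable def fold (A B : ℝ → E) (x : ℝ) : E :=
  if Int.fract x ≤ 1 / 2 then A (2 * Int.fract x) else B (2 - 2 * Int.fract x)

theorem fold_periodic (A B : ℝ → E) : Function.Periodic (fold A B) 1 := fun x => by
  simp only [fold, Int.fract_add_one]

theorem map_fold (g : E → F) (A B : ℝ → E) (x : ℝ) :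
    g (fold A B x) = fold (fun y => g (A y)) (fun y => g (B y)) x := by
  simp only [fold]
  split_ifs <;> rfl

theorem fold_of_mem_left (A B : ℝ → E) {x : ℝ} (hx : x ∈ Icc (0 : ℝ) (1 / 2)) :
    fold A B x = A (2 * x) := by
  have h : Int.fract x = x := Int.fract_eq_self.mpr ⟨hx.1, by linarith [hx.2]⟩
  rw [fold, h, if_pos hx.2]

theorem fold_of_mem_right (A B : ℝ → E) {x : ℝ} (hx : x ∈ Ioo (1 / 2 : ℝ) 1) :
    fold A B x = B (2 - 2 * x) := by
  have h : Int.fract x = x := Int.fract_eq_self.mpr ⟨by linarith [hx.1], hx.2⟩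
  rw [fold, h, if_neg (not_le.mpr hx.1)]

variable [NormedAddCommGroup E] {A B : ℝ → E}

theorem intervalIntegrable_fold_left (hA : IntervalIntegrable A volume 0 1) :
    IntervalIntegrable (fold A B) volume 0 (1 / 2) := by
  have h := hA.comp_mul_left (c := 2)
  rw [zero_div] at h
  refine h.congr fun t ht => ?_
  rw [uIoc_of_le (by norm_num)] at ht
  exact (fold_of_mem_left A B (Ioc_subset_Icc_self ht)).symm

theorem intervalIntegrable_fold_right (hB : IntervalIntegrable B volume 0 1) :
    IntervalIntegrable (fold A B) volume (1 / 2) 1 := by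
  have h := (hB.comp_sub_left 2).comp_mul_left (c := 2)
  norm_num at h
  refine h.symm.congr_ae ?_
  filter_upwards [ae_mem_Ioo (1 / 2) 1] with t ht
  norm_num at ht
  exact (fold_of_mem_right A B (by simpa using ht)).symm

theorem intervalIntegrable_fold (hA : IntervalIntegrable A volume 0 1)
    (hB : IntervalIntegrable B volume 0 1) (a b : ℝ) : IntervalIntegrable (fold A B) volume a b :=
  (fold_periodic A B).intervalIntegrable₀ one_ne_zero
    ((intervalIntegrable_fold_left hA).trans (intervalIntegrable_fold_right hB)) a b

variable [NormedSpace ℝ E]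

theorem integral_fold_left (A B : ℝ → E) {x : ℝ} (hx : x ∈ Icc (0 : ℝ) (1 / 2)) :
    ∫ t in (0 : ℝ)..x, fold A B t = (1 / 2 : ℝ) • ∫ t in (0 : ℝ)..(2 * x), A t := by
  rw [intervalIntegral.integral_congr (g := fun t => A (2 * t)) fun t ht => ?_,
    intervalIntegral.integral_comp_mul_left A two_ne_zero, mul_zero, one_div]
  rw [uIcc_of_le hx.1] at ht
  exact fold_of_mem_left A B ⟨ht.1, ht.2.trans hx.2⟩

theorem integral_fold_right (A B : ℝ → E) {x : ℝ} (hx : x ∈ Icc (1 / 2 : ℝ) 1) :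
    ∫ t in (1 / 2 : ℝ)..x, fold A B t = (1 / 2 : ℝ) • ∫ t in (2 - 2 * x)..1, B t := by
  rw [intervalIntegral.integral_congr_Ioo_of_le (g := fun t => B (2 - 2 * t)) hx.1 fun t ht => ?_,
    intervalIntegral.integral_comp_sub_mul B two_ne_zero, one_div]
  · norm_num
  · exact fold_of_mem_right A B ⟨ht.1, ht.2.trans_le hx.2⟩

theorem integral_fold (hA : IntervalIntegrable A volume 0 1)
    (hB : IntervalIntegrable B volume 0 1) :
    ∫ t in (0 : ℝ)..1, fold A B t =
      (1 / 2 : ℝ) • (∫ t in (0 : ℝ)..1, A t) + (1 / 2 : ℝ) • ∫ t in (0 : ℝ)..1, B t := by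
  rw [← intervalIntegral.integral_add_adjacent_intervals (intervalIntegrable_fold_left hA)
    (intervalIntegrable_fold_right hB), integral_fold_left A B (by norm_num),
    integral_fold_right A B (by norm_num)]
  norm_num

end fold

/-! ### Drops and figure eights from tangent data -/

/-- The derivative of the tangent of the figure eight that runs through a drop and then, backwards,
through its point reflection. -/
noncomputable def eightDeriv (u : ℝ → Plane) : ℝ → Plane :=
  fold (fun t => (2 : ℝ) • u t) (fun t => (-2 : ℝ) • u t)

theorem norm_eightDeriv_sq (u : ℝ → Plane) (x : ℝ) :
    ‖eightDeriv u x‖ ^ 2 = fold (fun t => 4 * ‖u t‖ ^ 2) (fun t => 4 * ‖u t‖ ^ 2) x := by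
  rw [eightDeriv, map_fold (fun p : Plane => ‖p‖ ^ 2)]
  congr 1 <;> ext t <;> rw [norm_smul, mul_pow] <;> norm_num

namespace IsTangentData

variable {v : Plane} {u : ℝ → Plane}

theorem neg (h : IsTangentData v u) : IsTangentData (-v) (-u) where
  memLp := h.memLp.neg
  norm_eq_one x hx := by
    simp only [Pi.neg_apply, intervalIntegral.integral_neg, ← neg_add, norm_neg]
    exact h.norm_eq_one x hx
  integral_eq_zero := by
    simp only [Pi.neg_apply, intervalIntegral.integral_neg, ← neg_add, h.integral_eq_zero, neg_zero]

theorem curveOfTangent_one (h : IsTangentData v u) (c : ℝ) : curveOfTangent c v u 1 = 0 := by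
  rw [curveOfTangent, intervalIntegral.integral_smul, h.integral_eq_zero, smul_zero]

/-- The speed `√μ` is the length for which the bending energy and the length are equal. -/
theorem isDrop_curveOfTangent (h : IsTangentData v u)
    (hu : ∀ a b, MemLp u 2 (volume.restrict (Icc a b))) {μ : ℝ}
    (hμ : ∫ t in (0 : ℝ)..1, ‖u t‖ ^ 2 = μ) :
    IsDrop (curveOfTangent (√μ) v u) ∧ energy (curveOfTangent (√μ) v u) = 2 * √μ := by
  have hpos : 0 < μ := hμ ▸ h.integral_norm_sq_pos
  have hc : 0 < √μ := Real.sqrt_pos.mpr hpos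
  refine ⟨⟨isRegularH2On_curveOfTangent hu hc zero_lt_one h.norm_eq_one, ?_⟩, ?_⟩
  · rw [h.curveOfTangent_one, curveOfTangent, intervalIntegral.integral_same]
  · rw [energy_curveOfTangent hu hc h.norm_eq_one, hμ]
    nth_rewrite 3 [← Real.mul_self_sqrt hpos.le]
    rw [inv_mul_cancel_left₀ hc.ne', two_mul]

theorem intervalIntegrable_norm_sq (h : IsTangentData v u) :
    IntervalIntegrable (fun t => 4 * ‖u t‖ ^ 2) volume 0 1 := by
  refine IntervalIntegrable.const_mul ?_ 4
  rw [intervalIntegrable_iff_integrableOn_Ioc_of_le zero_le_one]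
  exact h.memLp.integrable_norm_pow two_ne_zero

theorem intervalIntegrable_eightDeriv (h : IsTangentData v u) (a b : ℝ) :
    IntervalIntegrable (eightDeriv u) volume a b :=
  intervalIntegrable_fold ((intervalIntegrable_of_memLp h.memLp).smul (2 : ℝ))
    ((intervalIntegrable_of_memLp h.memLp).smul (-2 : ℝ)) a b

theorem memLp_eightDeriv (h : IsTangentData v u) (a b : ℝ) :
    MemLp (eightDeriv u) 2 (volume.restrict (Icc a b)) := by
  rcases lt_or_ge b a with hab | hab
  · simp [Icc_eq_empty_of_lt hab]
  have h1 : IntegrableOn (eightDeriv u) (Icc a b) :=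
    (intervalIntegrable_iff_integrableOn_Icc_of_le hab).mp (h.intervalIntegrable_eightDeriv a b)
  refine (memLp_two_iff_integrable_sq_norm h1.aestronglyMeasurable).mpr ?_
  simp only [norm_eightDeriv_sq]
  exact (intervalIntegrable_iff_integrableOn_Icc_of_le hab).mp
    (intervalIntegrable_fold h.intervalIntegrable_norm_sq h.intervalIntegrable_norm_sq a b)

theorem integral_norm_eightDeriv_sq (h : IsTangentData v u) :
    ∫ t in (0 : ℝ)..1, ‖eightDeriv u t‖ ^ 2 = 4 * ∫ t in (0 : ℝ)..1, ‖u t‖ ^ 2 := by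
  simp only [norm_eightDeriv_sq]
  rw [integral_fold h.intervalIntegrable_norm_sq h.intervalIntegrable_norm_sq,
    intervalIntegral.integral_const_mul, smul_eq_mul]
  ring

/-- The tangent of the figure eight is that of the drop, traversed forth and back: reversing the
orientation and reflecting in a point both change the sign of the tangent. -/
theorem tangent_eightDeriv (h : IsTangentData v u) (x : ℝ) :
    v + ∫ t in (0 : ℝ)..x, eightDeriv u t =
      fold (fun y => v + ∫ t in (0 : ℝ)..y, u t) (fun y => v + ∫ t in (0 : ℝ)..y, u t) x := by
  have hint := h.intervalIntegrable_eightDeriv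
  have hu := intervalIntegrable_of_memLp h.memLp
  have hleft : ∀ y ∈ Icc (0 : ℝ) (1 / 2),
      ∫ t in (0 : ℝ)..y, eightDeriv u t = ∫ t in (0 : ℝ)..(2 * y), u t := fun y hy => by
    rw [eightDeriv, integral_fold_left _ _ hy, intervalIntegral.integral_smul, smul_smul]
    norm_num
  have hright : ∀ y ∈ Icc (1 / 2 : ℝ) 1,
      ∫ t in (0 : ℝ)..y, eightDeriv u t = ∫ t in (0 : ℝ)..(2 - 2 * y), u t := fun y hy => by
    rw [← intervalIntegral.integral_add_adjacent_intervals (hint 0 (1 / 2)) (hint _ _),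
      hleft _ (by norm_num), eightDeriv, integral_fold_right _ _ hy,
      intervalIntegral.integral_smul, smul_smul]
    have hm : 2 - 2 * y ∈ uIcc (0 : ℝ) 1 := by
      rw [uIcc_of_le zero_le_one]
      exact ⟨by linarith [hy.2], by linarith [hy.1]⟩
    have := intervalIntegral.integral_add_adjacent_intervals
      (hu.mono_set (uIcc_subset_uIcc left_mem_uIcc hm))
      (hu.mono_set (uIcc_subset_uIcc hm right_mem_uIcc))
    norm_num
    rw [← this, add_neg_cancel_right]
  have hper : Function.Periodic (fun x => v + ∫ t in (0 : ℝ)..x, eightDeriv u t) 1 := fun y => by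
    have h1 := hright 1 (by norm_num)
    norm_num at h1
    have h2 := (fold_periodic (fun t => (2 : ℝ) • u t)
      (fun t => (-2 : ℝ) • u t)).intervalIntegral_add_eq y 0
    simp only [zero_add] at h2
    change ∫ t in y..(y + 1), eightDeriv u t = ∫ t in (0 : ℝ)..1, eightDeriv u t at h2
    simp only
    rw [← intervalIntegral.integral_add_adjacent_intervals (hint 0 y) (hint y (y + 1)), h2, h1,
      add_zero]
  have h1 := hper.sub_int_mul_eq ⌊x⌋ (x := x)
  rw [mul_one] at h1
  rw [← h1]
  change v + ∫ t in (0 : ℝ)..(Int.fract x), eightDeriv u t = _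
  rw [fold]
  split_ifs with hx
  · rw [hleft _ ⟨Int.fract_nonneg x, hx⟩]
  · rw [hright _ ⟨(not_le.mp hx).le, (Int.fract_lt_one x).le⟩]

theorem norm_tangent_eightDeriv (h : IsTangentData v u) (x : ℝ) :
    ‖v + ∫ t in (0 : ℝ)..x, eightDeriv u t‖ = 1 := by
  rw [h.tangent_eightDeriv, fold]
  have h0 := Int.fract_nonneg x
  have h1 := (Int.fract_lt_one x).le
  split_ifs with hx
  · exact h.norm_eq_one _ ⟨by linarith, by linarith⟩
  · exact h.norm_eq_one _ ⟨by linarith, by linarith⟩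

theorem curveOfTangent_eightDeriv_half (h : IsTangentData v u) (c : ℝ) :
    curveOfTangent c v (eightDeriv u) (1 / 2) = 0 := by
  simp only [curveOfTangent, h.tangent_eightDeriv, intervalIntegral.integral_smul]
  rw [integral_fold_left _ _ (by norm_num)]
  norm_num [h.integral_eq_zero]

theorem curveOfTangent_eightDeriv_periodic (h : IsTangentData v u) (c : ℝ) :
    Function.Periodic (curveOfTangent c v (eightDeriv u)) 1 := by
  have hT : IntervalIntegrable (fun x => v + ∫ t in (0 : ℝ)..x, u t) volume 0 1 := by
    refine ContinuousOn.intervalIntegrable ?_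
    rw [uIcc_of_le zero_le_one]
    exact h.continuousOn_tangent
  intro x
  simp only [curveOfTangent, h.tangent_eightDeriv, intervalIntegral.integral_smul]
  rw [← intervalIntegral.integral_add_adjacent_intervals (intervalIntegrable_fold hT hT 0 x)
    (intervalIntegrable_fold hT hT x (x + 1)), (fold_periodic _ _).intervalIntegral_add_eq x 0,
    zero_add, integral_fold hT hT, h.integral_eq_zero]
  simp

/-- The figure eight made of a drop of energy `2 √μ` and its point reflection. Its length `2 √μ` is
twice that of the drop, and it meets the base point at the parameters `0` and `1 / 2`. -/
theorem exists_figureEight (h : IsTangentData v u) {μ : ℝ}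
    (hμ : ∫ t in (0 : ℝ)..1, ‖u t‖ ^ 2 = μ) :
    4 * √μ ∈ selfIntersectingEnergies := by
  have hpos : 0 < μ := hμ ▸ h.integral_norm_sq_pos
  have hc : 0 < 2 * √μ := by positivity
  have hper := h.curveOfTangent_eightDeriv_periodic (2 * √μ)
  have hlift : lift hper.lift = curveOfTangent (2 * √μ) v (eightDeriv u) := rfl
  refine ⟨hper.lift, fun a b hab => ?_, ⟨((0 : ℝ) : UnitAddCircle), ((1 / 2 : ℝ) : UnitAddCircle),
    ?_, ?_⟩, ?_⟩
  · rw [hlift]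
    exact isRegularH2On_curveOfTangent h.memLp_eightDeriv hc hab
      fun x _ => h.norm_tangent_eightDeriv x
  · rw [Ne, AddCircle.coe_eq_coe_iff_of_mem_Ico (p := (1 : ℝ)) (a := 0) (by norm_num) (by norm_num)]
    norm_num
  · rw [hper.lift_coe, hper.lift_coe, h.curveOfTangent_eightDeriv_half, curveOfTangent,
      intervalIntegral.integral_same]
  · rw [closedEnergy, hlift, energy_curveOfTangent h.memLp_eightDeriv hc
      fun x _ => h.norm_tangent_eightDeriv x, h.integral_norm_eightDeriv_sq, hμ]
    have h1 : √μ ≠ 0 := (Real.sqrt_pos.mpr hpos).ne'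
    field_simp
    rw [Real.sq_sqrt hpos.le]
    ring

end IsTangentData

/-! ### Closed curves with a self-intersection, and minimizers -/

theorem deriv_periodic {f : ℝ → Plane} {c : ℝ} (h : Function.Periodic f c) :
    Function.Periodic (deriv f) c := fun x => by
  rw [← deriv_comp_add_const, h.funext]

theorem energyDensity_periodic {f : ℝ → Plane} {c : ℝ} (h : Function.Periodic f c) :
    Function.Periodic (energyDensity f) c := fun x => by
  have h1 := deriv_periodic h
  have h2 : Function.Periodic (fun y => ‖deriv f y‖⁻¹ • deriv f y) c := fun y => by
    simp only [h1 y]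
  simp only [energyDensity, h1 x, deriv_periodic h2 x]

/-- A self-intersection splits a closed curve into two drops. -/
theorem le_closedEnergy_of_self_intersection {e : ℝ}
    (he : ∀ (f : ℝ → Plane) (a b : ℝ), a < b → IsRegularH2On f a b → f a = f b →
      e ≤ ∫ x in a..b, energyDensity f x)
    {φ : UnitAddCircle → Plane} (hφ : IsClosedRegularH2 φ) {s₁ s₂ : UnitAddCircle}
    (hne : s₁ ≠ s₂) (heq : φ s₁ = φ s₂) : 2 * e ≤ closedEnergy φ := by
  obtain ⟨a, ha, rfl⟩ := AddCircle.eq_coe_Ico s₁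
  obtain ⟨b, hb, rfl⟩ := AddCircle.eq_coe_Ico s₂
  wlog hab : a < b generalizing a b
  · refine this b hb a ha hne.symm heq.symm (lt_of_le_of_ne (not_lt.mp hab) fun h => hne ?_)
    rw [h]
  have hper : Function.Periodic (lift φ) 1 := fun x => by
    rw [lift, lift, AddCircle.coe_add_period]
  -- The two drops live on `[a, b]` and on `[b, a + 1]`.
  have hb1 : b < a + 1 := by linarith [ha.1, hb.2]
  have h1 := he (lift φ) a b hab (hφ a b hab) heq
  have h2 := he (lift φ) b (a + 1) hb1 (hφ b _ hb1) (heq.symm.trans (hper a).symm)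
  have h3 := (energyDensity_periodic hper).intervalIntegral_add_eq 0 a
  rw [zero_add] at h3
  rw [closedEnergy, energy_eq_integral_energyDensity, h3,
    ← intervalIntegral.integral_add_adjacent_intervals
      ((hφ a b hab).intervalIntegrable_energyDensity hab)
      ((hφ b _ hb1).intervalIntegrable_energyDensity hb1)]
  linarith

/-- There is a minimal value `e` of the energy of drops, attained by two drops which are point
reflections of each other in the origin, while twice this value is attained by a figure eight. -/
theorem exists_minimal_drops : ∃ e : ℝ,
    (∀ (f : ℝ → Plane) (a b : ℝ), a < b → IsRegularH2On f a b → f a = f b →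
      e ≤ ∫ x in a..b, energyDensity f x) ∧
    (∃ γ : ℝ → Plane, IsDrop γ ∧ IsDrop (-γ) ∧ γ 0 = 0 ∧ energy γ = e ∧ energy (-γ) = e) ∧
    2 * e ∈ selfIntersectingEnergies := by
  obtain ⟨v, u₀, hu₀, hmin⟩ := exists_minimal_isTangentData
  -- Extension by zero, so that the curve is defined and square integrable on the whole line.
  set u : ℝ → Plane := (Ioc 0 1).indicator u₀ with hu_def
  have hae : u =ᵐ[unitVol] u₀ := indicator_ae_eq_restrict measurableSet_Ioc
  have hu : IsTangentData v u := hu₀.congr_ae hae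
  have hLp : ∀ a b, MemLp u 2 (volume.restrict (Icc a b)) := fun a b =>
    ((memLp_indicator_iff_restrict measurableSet_Ioc).mpr hu₀.memLp).restrict _
  have hLp' : ∀ a b, MemLp (-u) 2 (volume.restrict (Icc a b)) := fun a b => (hLp a b).neg
  have hmin' : ∀ v' u', IsTangentData v' u' →
      ∫ t in (0 : ℝ)..1, ‖u t‖ ^ 2 ≤ ∫ t in (0 : ℝ)..1, ‖u' t‖ ^ 2 := fun v' u' h' => by
    refine le_of_eq_of_le (intervalIntegral.integral_congr_ae_restrict ?_) (hmin v' u' h')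
    rw [uIoc_of_le zero_le_one]
    exact hae.mono fun t ht => by simp only [ht]
  generalize hμ : ∫ t in (0 : ℝ)..1, ‖u t‖ ^ 2 = μ at hmin'
  have hneg : curveOfTangent (√μ) (-v) (-u) = -curveOfTangent (√μ) v u := by
    ext1 x
    simp only [curveOfTangent, Pi.neg_apply, intervalIntegral.integral_neg, ← neg_add, smul_neg]
  have hd := hu.isDrop_curveOfTangent hLp hμ
  have hd' := hu.neg.isDrop_curveOfTangent hLp' (μ := μ) (by simpa using hμ)
  rw [hneg] at hd'
  refine ⟨2 * √μ, fun f a b hab h hclosed => h.two_sqrt_le_integral_energyDensity hab hclosed hmin',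
    ⟨_, hd.1, hd'.1, ?_, hd.2, hd'.2⟩, ?_⟩
  · rw [curveOfTangent, intervalIntegral.integral_same]
  · convert hu.exists_figureEight hμ using 1
    ring

end ElasticDrop

theorem mainTheorem9 :
    (sInf ElasticDrop.doubleDropEnergies = sInf ElasticDrop.symmetricDoubleDropEnergies ∧
      sInf ElasticDrop.symmetricDoubleDropEnergies = sInf ElasticDrop.selfIntersectingEnergies ∧
      sInf ElasticDrop.selfIntersectingEnergies = 2 * ElasticDrop.m) ∧
    (IsLeast ElasticDrop.doubleDropEnergies (sInf ElasticDrop.doubleDropEnergies) ∧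
      IsLeast ElasticDrop.symmetricDoubleDropEnergies
        (sInf ElasticDrop.symmetricDoubleDropEnergies) ∧
      IsLeast ElasticDrop.selfIntersectingEnergies
        (sInf ElasticDrop.selfIntersectingEnergies)) := by
  obtain ⟨e, he, ⟨γ, hγ, hγ', h0, hE, hE'⟩, h8⟩ := ElasticDrop.exists_minimal_drops
  have hdrop : ∀ f, ElasticDrop.IsDrop f → e ≤ ElasticDrop.energy f := fun f hf => by
    rw [ElasticDrop.energy_eq_integral_energyDensity]
    exact he f 0 1 zero_lt_one hf.regularH2 hf.closed
  have hm : IsLeast {e : ℝ | ∃ f, ElasticDrop.IsDrop f ∧ ElasticDrop.energy f = e} e :=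
    ⟨⟨γ, hγ, hE⟩, fun x ⟨f, hf, hx⟩ => hx ▸ hdrop f hf⟩
  let D : ElasticDrop.DoubleDrop := ⟨γ, -γ, hγ, hγ', by simp [h0]⟩
  have hD : D.totalEnergy = 2 * e := by
    rw [ElasticDrop.DoubleDrop.totalEnergy, hE, hE', two_mul]
  have hDsymm : D.IsSymmetric := ⟨Homeomorph.refl _, fun t => by
    simp [D, ElasticDrop.DoubleDrop.fourPoint, h0, Equiv.pointReflection_apply]⟩
  have hlow : ∀ D : ElasticDrop.DoubleDrop, 2 * e ≤ D.totalEnergy := fun D => by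
    rw [ElasticDrop.DoubleDrop.totalEnergy]
    linarith [hdrop _ D.isDrop₁, hdrop _ D.isDrop₂]
  have hn : IsLeast ElasticDrop.doubleDropEnergies (2 * e) :=
    ⟨⟨D, hD⟩, fun x ⟨D', hx⟩ => hx ▸ hlow D'⟩
  have hns : IsLeast ElasticDrop.symmetricDoubleDropEnergies (2 * e) :=
    ⟨⟨D, hDsymm, hD⟩, fun x ⟨D', _, hx⟩ => hx ▸ hlow D'⟩
  have hnc : IsLeast ElasticDrop.selfIntersectingEnergies (2 * e) :=
    ⟨h8, fun x ⟨φ, hφ, ⟨s₁, s₂, hne, heq⟩, hx⟩ =>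
      hx ▸ ElasticDrop.le_closedEnergy_of_self_intersection he hφ hne heq⟩
  rw [ElasticDrop.m, hn.csInf_eq, hns.csInf_eq, hnc.csInf_eq, hm.csInf_eq]
  exact ⟨⟨rfl, rfl, rfl⟩, hn, hns, hnc⟩
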